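/- Let $E,F$ be separable real Banach spaces with duals $E',F'$, let $(\Omega,\mathcal A,\mu)$ be a probability space, and let $X:\Omega\to E$ and $Y:\Omega\to F$ be jointly Gaussian random variables (that is, $e'(X)+f'(Y)$ is a possibly degenerate real Gaussian variable for all $e'\in E'$, $f'\in F'$) with $\mathbb E(X)=0$ and $\mathbb E(Y)=0$. Put $Z:=\mathbb E(X\,|\,Y)$, the conditional expectation of $X$ given the smallest $\sigma$-algebra for which all $f'(Y)$, $f'\in F'$, are measurable. For a square integrable random variable $U$ with values in a Banach space $B$, let $G_U\subseteq L^2(\mu)$ be the closure of $\{b'(U) : b'\in B'\}$, and let $$W_U:=\Big\{\int_\Omega g\,U\,d\mu : g\in G_U\Big\}\subseteq B,\qquad \|w\|_{W_U}:=\inf\Big\{\|g\|_{L^2(\mu)} : g\in G_U,\ w=\int_\Omega g\,U\,d\mu\Big\},$$ which is a Hilbert space. Let $\hat V_U:L^2(\mu)\to W_U$, $\hat V_U g:=\int_\Omega g\,U\,d\mu$, and let $M_W:=\hat V_Z\hat V_Y^*:W_Y\to W_Z$, where $\hat V_Y^*$ is the Hilbert space adjoint. **Theorem.** Suppose that $G_Y=G_Z$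 and that $W_Y$ is dense in $F$. Then there are a Banach space $\tilde E$ with $W_Z\subseteq\tilde E$ (through an injective linear map that is continuous for the norm of $W_Z$) and an isometric isomorphism $\hat M:F\to\tilde E$ such that $\hat M w=M_W w$ for all $w\in W_Y$ and $\hat M Y=Z$ almost everywhere in the following sense. * For every orthonormal basis $(r_i)_{i\in J}$ of $G_Z$, $J$ countable, and all finite sets $S_1\subseteq S_2\subseteq\dots$ with union $J$, the $W_Z$-valued partial sums $$\sum_{i\in S_n} r_i\int_\Omega r_i\,Z\,d\mu$$ converge almost everywhere, as $n\to\infty$, to $Z$ in $E$ and to $\hat M Y$ in $\tilde E$. * Consequently, if $H$ is a Hausdorff topological vector space and $E\to H$, $\tilde E\to H$ are continuous linear maps that agree on $W_Z$, then the images of $Z$ and of $\hat M Y$ in $H$ are equal almost everywhere. -/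

import Mathlib

open MeasureTheory ProbabilityTheory Filter Topology
open scoped ENNReal InnerProductSpace

universe u v w

noncomputable section

namespace GaussianConditioning

/-- The `σ`-algebra `σ(Y)`: the smallest `σ`-algebra for which `Y` is weakly measurable. -/
@[reducible] def sigmaOf {Ω F : Type*} [NormedAddCommGroup F] [NormedSpace ℝ F] (Y : Ω → F) :
    MeasurableSpace Ω :=
  ⨆ f' : StrongDual ℝ F, MeasurableSpace.comap (fun ω => f' (Y ω)) (borel ℝ)

/-- The conditional expectation `Z = 𝔼(X|Y) = 𝔼(X|σ(Y))`. -/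
def condMean {Ω E F : Type*} [MeasurableSpace Ω] [NormedAddCommGroup E] [NormedSpace ℝ E]
    [CompleteSpace E] [NormedAddCommGroup F] [NormedSpace ℝ F]
    (X : Ω → E) (Y : Ω → F) (μ : Measure Ω) : Ω → E :=
  μ[X | sigmaOf Y]

theorem memLp_condMean {Ω E F : Type*} [MeasurableSpace Ω] [NormedAddCommGroup E]
    [NormedSpace ℝ E] [CompleteSpace E] [NormedAddCommGroup F] [NormedSpace ℝ F]
    {X : Ω → E} {μ : Measure Ω} (hX : MemLp X 2 μ) (Y : Ω → F) : MemLp (condMean X Y μ) 2 μ :=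
  hX.condExp one_le_two

section Wiener

variable {Ω E : Type*} [MeasurableSpace Ω] {μ : Measure Ω}
  [NormedAddCommGroup E] [NormedSpace ℝ E] {X : Ω → E}

/-- The linear map `e' ↦ e'(X)` from the dual of `E` to `L²(μ)`. -/
def dualEval (hX : MemLp X 2 μ) : StrongDual ℝ E →ₗ[ℝ] Lp ℝ 2 μ where
  toFun e' := (e'.comp_memLp' hX).toLp
  map_add' _ _ := rfl
  map_smul' _ _ := rfl

/-- The space `G_X`: the closure of `{e'(X) | e' ∈ E'}` in `L²(μ)`. -/
def gaussSpace (hX : MemLp X 2 μ) : Submodule ℝ (Lp ℝ 2 μ) :=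
  (LinearMap.range (dualEval hX)).topologicalClosure

instance (hX : MemLp X 2 μ) : CompleteSpace (gaussSpace hX) :=
  inferInstanceAs (CompleteSpace (LinearMap.range (dualEval hX)).topologicalClosure)

theorem integrable_smul (hX : MemLp X 2 μ) (g : Lp ℝ 2 μ) :
    Integrable (fun ω => g ω • X ω) μ :=
  by
  rw [← memLp_one_iff_integrable]
  exact hX.smul (Lp.memLp g)

/-- The linear map `g ↦ ∫ g X dμ` from `L²(μ)` to `E`. -/
def weightedMean (hX : MemLp X 2 μ) : Lp ℝ 2 μ →ₗ[ℝ] E where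
  toFun g := ∫ ω, g ω • X ω ∂μ
  map_add' g h := by
    rw [← integral_add (integrable_smul hX g) (integrable_smul hX h)]
    refine integral_congr_ae ?_
    filter_upwards [Lp.coeFn_add g h] with ω hω
    rw [hω, Pi.add_apply, add_smul]
  map_smul' c g := by
    rw [RingHom.id_apply, ← integral_smul]
    refine integral_congr_ae ?_
    filter_upwards [Lp.coeFn_smul c g] with ω hω
    rw [hω, Pi.smul_apply, smul_eq_mul, mul_smul]

/-- The underlying linear subspace of `W_X` in `E`. -/
def wienerSubmodule (hX : MemLp X 2 μ) : Submodule ℝ E :=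
  (gaussSpace hX).map (weightedMean hX)

/-- The abstract Wiener space `W_X = {e ∈ E | ∃ g ∈ G_X, e = ∫ g X dμ}`. It is a type of its own,
because it does not carry the norm of `E`. -/
def WienerSpace (hX : MemLp X 2 μ) : Type _ := ↥(wienerSubmodule hX)

instance (hX : MemLp X 2 μ) : AddCommGroup (WienerSpace hX) :=
  inferInstanceAs (AddCommGroup ↥(wienerSubmodule hX))

instance (hX : MemLp X 2 μ) : Module ℝ (WienerSpace hX) :=
  inferInstanceAs (Module ℝ ↥(wienerSubmodule hX))

/-- The inclusion of `W_X` in `E`. -/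
def WienerSpace.incl (hX : MemLp X 2 μ) : WienerSpace hX →ₗ[ℝ] E := (wienerSubmodule hX).subtype

variable [CompleteSpace E]

theorem dual_weightedMean (hX : MemLp X 2 μ) (e' : StrongDual ℝ E) (g : Lp ℝ 2 μ) :
    e' (weightedMean hX g) = ⟪dualEval hX e', g⟫_ℝ := by
  rw [L2.inner_def]
  change e' (∫ ω, g ω • X ω ∂μ) = _
  rw [← e'.integral_comp_comm (integrable_smul hX g)]
  refine integral_congr_ae ?_
  filter_upwards [(e'.comp_memLp' hX).coeFn_toLp] with ω hω
  change e' (g ω • X ω) = inner ℝ ((e'.comp_memLp' hX).toLp (e' ∘ X) ω) (g ω)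
  rw [hω]
  simp

theorem weightedMean_eq_zero_iff (hX : MemLp X 2 μ) (g : Lp ℝ 2 μ) :
    weightedMean hX g = 0 ↔ g ∈ (gaussSpace hX)ᗮ := by
  rw [gaussSpace, Submodule.orthogonal_closure, Submodule.mem_orthogonal]
  constructor
  · rintro h _ ⟨e', rfl⟩
    rw [← dual_weightedMean, h, map_zero]
  · intro h
    refine SeparatingDual.eq_zero_of_forall_dual_eq_zero (R := ℝ) fun e' => ?_
    rw [dual_weightedMean]
    exact h _ ⟨e', rfl⟩

theorem weightedMean_proj (hX : MemLp X 2 μ) (g : Lp ℝ 2 μ) :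
    weightedMean hX ((gaussSpace hX).starProjection g) = weightedMean hX g := by
  rw [← sub_eq_zero, ← map_sub, weightedMean_eq_zero_iff, ← neg_sub, Submodule.neg_mem_iff]
  exact Submodule.sub_starProjection_mem_orthogonal g

theorem weightedMean_mem (hX : MemLp X 2 μ) (g : Lp ℝ 2 μ) :
    weightedMean hX g ∈ wienerSubmodule hX :=
  ⟨_, Submodule.starProjection_apply_mem _ g, weightedMean_proj hX g⟩

/-- The bijection `V_X : G_X → W_X`, `g ↦ ∫ g X dμ`. -/
def wienerEquiv (hX : MemLp X 2 μ) : gaussSpace hX ≃ₗ[ℝ] WienerSpace hX :=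
  LinearEquiv.ofBijective
    (LinearMap.codRestrict (wienerSubmodule hX) ((weightedMean hX).domRestrict (gaussSpace hX))
      fun g => weightedMean_mem hX g)
    ⟨by
      refine (injective_iff_map_eq_zero _).2 fun g hg => ?_
      have h : weightedMean hX g = 0 := congrArg Subtype.val hg
      rw [weightedMean_eq_zero_iff] at h
      exact Subtype.ext ((Submodule.mem_bot ℝ).1
        ((Submodule.inf_orthogonal_eq_bot (gaussSpace hX)).le ⟨g.2, h⟩)),
    by
      rintro ⟨_, g, hg, rfl⟩
      exact ⟨⟨g, hg⟩, rfl⟩⟩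

/-- The norm of `W_X`. By `norm_eq_sInf` below, it is the infimum of the norms of all `g ∈ G_X` with
`e = ∫ g X dμ`. -/
instance (hX : MemLp X 2 μ) : NormedAddCommGroup (WienerSpace hX) :=
  NormedAddCommGroup.induced _ _ (wienerEquiv hX).symm (wienerEquiv hX).symm.injective

theorem norm_def (hX : MemLp X 2 μ) (w : WienerSpace hX) : ‖w‖ = ‖(wienerEquiv hX).symm w‖ := rfl

theorem norm_eq_sInf (hX : MemLp X 2 μ) (w : WienerSpace hX) :
    ‖w‖ = sInf {t : ℝ | ∃ g ∈ gaussSpace hX,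
      WienerSpace.incl hX w = ∫ ω, g ω • X ω ∂μ ∧ t = ‖g‖} := by
  have h : {t : ℝ | ∃ g ∈ gaussSpace hX,
      WienerSpace.incl hX w = ∫ ω, g ω • X ω ∂μ ∧ t = ‖g‖} = {‖w‖} := by
    ext t
    constructor
    · rintro ⟨g, hg, hw, rfl⟩
      have : w = wienerEquiv hX ⟨g, hg⟩ := Subtype.ext hw
      rw [Set.mem_singleton_iff, norm_def, this, LinearEquiv.symm_apply_apply]
      rfl
    · rintro rfl
      refine ⟨(wienerEquiv hX).symm w, Subtype.coe_prop _, ?_, rfl⟩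
      exact congrArg (WienerSpace.incl hX) ((wienerEquiv hX).apply_symm_apply w).symm
  rw [h, csInf_singleton]

/-- The inner product that induces the norm of `W_X`. -/
instance (hX : MemLp X 2 μ) : InnerProductSpace ℝ (WienerSpace hX) where
  norm_smul_le c w := by
    rw [norm_def, norm_def, map_smul, norm_smul]
  inner v w := ⟪(wienerEquiv hX).symm v, (wienerEquiv hX).symm w⟫_ℝ
  norm_sq_eq_re_inner w := norm_sq_eq_re_inner (𝕜 := ℝ) ((wienerEquiv hX).symm w)
  conj_inner_symm v w := inner_conj_symm _ _
  add_left u v w := by rw [map_add, inner_add_left]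
  smul_left v w c := by
    rw [map_smul]
    exact inner_smul_left (𝕜 := ℝ) ((wienerEquiv hX).symm v) _ c

/-- `V_X : G_X → W_X` is an isometric isomorphism. -/
def wienerIsometry (hX : MemLp X 2 μ) : gaussSpace hX ≃ₗᵢ[ℝ] WienerSpace hX where
  toLinearEquiv := wienerEquiv hX
  norm_map' g := by rw [norm_def, LinearEquiv.symm_apply_apply]

instance (hX : MemLp X 2 μ) : CompleteSpace (WienerSpace hX) :=
  (wienerIsometry hX).toIsometryEquiv.completeSpace_iff.1 inferInstance

/-- The operator `V̂_X : L²(μ) → W_X`, `g ↦ ∫ g X dμ`. -/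
def vHat (hX : MemLp X 2 μ) : Lp ℝ 2 μ →L[ℝ] WienerSpace hX :=
  LinearMap.mkContinuous
    (LinearMap.codRestrict (wienerSubmodule hX) (weightedMean hX) (weightedMean_mem hX) :
      Lp ℝ 2 μ →ₗ[ℝ] WienerSpace hX) 1 fun g => by
    have h : LinearMap.codRestrict (wienerSubmodule hX) (weightedMean hX) (weightedMean_mem hX) g
        = wienerIsometry hX ((gaussSpace hX).orthogonalProjectionOnto g) :=
      Subtype.ext (weightedMean_proj hX g).symm
    rw [one_mul]
    refine (congrArg (fun w : WienerSpace hX => ‖w‖) h).le.trans ?_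
    rw [LinearIsometryEquiv.norm_map]
    exact Submodule.norm_orthogonalProjectionOnto_apply_le _ g

theorem incl_vHat (hX : MemLp X 2 μ) (g : Lp ℝ 2 μ) :
    WienerSpace.incl hX (vHat hX g) = ∫ ω, g ω • X ω ∂μ := rfl

end Wiener

section Operator

variable {Ω E F : Type*} [MeasurableSpace Ω] {μ : Measure Ω}
  [NormedAddCommGroup E] [NormedSpace ℝ E] [CompleteSpace E]
  [NormedAddCommGroup F] [NormedSpace ℝ F] [CompleteSpace F] {Y : Ω → F} {Z : Ω → E}

/-- The operator `M_W = V̂_Z V̂_Y^* : W_Y → W_Z`. -/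
def opMW (hY : MemLp Y 2 μ) (hZ : MemLp Z 2 μ) : WienerSpace hY →L[ℝ] WienerSpace hZ :=
  (vHat hZ).comp (ContinuousLinearMap.adjoint (vHat hY))

/-- For a continuous linear map `j : W_Z → E₁` to a Banach space, `IsCopy hZ j U` says that the
random variable `U : Ω → E₁` is `Z`, viewed in `E₁` through `j`: for every orthonormal basis
`(r i)` of `G_Z` and every exhaustion of its countable index set by an increasing sequence of finite
sets, the partial sums of `∑ r i • ∫ r i Z dμ`, which are `W_Z`-valued, converge almost everywhere
to `Z` in `E` and, after application of `j`, to `U` in `E₁`. -/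
def IsCopy (hZ : MemLp Z 2 μ) {E₁ : Type*} [NormedAddCommGroup E₁] [NormedSpace ℝ E₁]
    (j : WienerSpace hZ →L[ℝ] E₁) (U : Ω → E₁) : Prop :=
  ∀ (J : Type) [Countable J] (r : HilbertBasis J ℝ (gaussSpace hZ)) (S : ℕ → Finset J),
    Monotone S → Tendsto S atTop atTop → ∀ᵐ ω ∂μ,
      Tendsto (fun n => WienerSpace.incl hZ
        (∑ i ∈ S n, (r i : Lp ℝ 2 μ) ω • vHat hZ (r i))) atTop (𝓝 (Z ω)) ∧
      Tendsto (fun n => j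
        (∑ i ∈ S n, (r i : Lp ℝ 2 μ) ω • vHat hZ (r i))) atTop (𝓝 (U ω))

end Operator

end GaussianConditioning

end

namespace GaussianConditioning

/-! ### Closed subspaces of `L²(μ)` that consist of centred Gaussian variables -/

section Gaussian

variable {Ω : Type*} [mΩ : MeasurableSpace Ω] {μ : Measure Ω}

/-! The maps `V_Y` and `V_Z` are isometries of one Hilbert space `G = G_Y = G_Z` onto `W_Y` and
`W_Z`, and `M_W = V_Z V_Y⁻¹` (`adjoint_vHat`). Hence `F` itself can serve as the space over `W_Z`:
embed `W_Z` in `F` by `V_Y V_Z⁻¹` (`transfer`) and let the isometry be the identity. On `W_Y` this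
is `transfer_opMW`.

The substance is the almost everywhere convergence. All functionals of `Y` and of `Z` lie in `G`, a
closed space of centred Gaussian variables (`isClosed_map_eq_gaussianReal`). In such a space
orthogonality means independence (`indepFun_of_inner_eq_zero`), so for an orthonormal basis `r` of
`G` the partial sum over `S n` is the conditional expectation given the `r i` with `i ∈ S n`
(`condExp_finsetFiltration`). Lévy's upward theorem (`tendsto_ae_condExp_banach`) then gives
convergence to `Y` and to `Z` along the same basis. The statement on `H` is uniqueness of limits,
applied to a countable basis of the separable space `G`. -/

theorem integral_norm_le_norm [IsProbabilityMeasure μ] (f : Lp ℝ 2 μ) : ∫ ω, ‖f ω‖ ∂μ ≤ ‖f‖ := by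
  rw [integral_norm_eq_lintegral_enorm (Lp.aestronglyMeasurable f), Lp.norm_def,
    ← eLpNorm_one_eq_lintegral_enorm]
  exact ENNReal.toReal_mono (Lp.eLpNorm_ne_top f)
    (eLpNorm_le_eLpNorm_of_exponent_le one_le_two (Lp.aestronglyMeasurable f))

theorem charFun_map_Lp (g : Lp ℝ 2 μ) (t : ℝ) :
    charFun (μ.map g) t = ∫ ω, Complex.exp (t * g ω * Complex.I) ∂μ := by
  rw [charFun_apply_real, integral_map (Lp.aestronglyMeasurable g).aemeasurable
    (by fun_prop)]

theorem norm_exp_mul_I_sub_le (x y : ℝ) :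
    ‖Complex.exp (x * Complex.I) - Complex.exp (y * Complex.I)‖ ≤ |x - y| := by
  have h : Complex.exp (x * Complex.I) - Complex.exp (y * Complex.I) =
      Complex.exp (y * Complex.I) * (Complex.exp (Complex.I * ↑(x - y)) - 1) := by
    rw [mul_sub, ← Complex.exp_add]
    push_cast
    ring_nf
  rw [h, norm_mul, Complex.norm_exp_ofReal_mul_I, one_mul]
  exact Real.norm_exp_I_mul_ofReal_sub_one_le

theorem integrable_exp_mul_I [IsProbabilityMeasure μ] (g : Lp ℝ 2 μ) (t : ℝ) :
    Integrable (fun ω => Complex.exp (t * g ω * Complex.I)) μ := by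
  refine Integrable.of_bound (C := 1) ?_ (ae_of_all _ fun ω => ?_)
  · have := Lp.aestronglyMeasurable g
    fun_prop
  · rw [← Complex.ofReal_mul, Complex.norm_exp_ofReal_mul_I]

/-- The map `x ↦ exp(itx)` is `|t|`-Lipschitz, and the `L¹` norm is at most the `L²` norm on a
probability space. -/
theorem continuous_charFun_map_Lp [IsProbabilityMeasure μ] (t : ℝ) :
    Continuous fun g : Lp ℝ 2 μ => charFun (μ.map g) t := by
  refine (LipschitzWith.of_dist_le_mul (K := ‖t‖₊) fun g h => ?_).continuous
  rw [charFun_map_Lp, charFun_map_Lp, dist_eq_norm, dist_eq_norm,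
    ← integral_sub (integrable_exp_mul_I g t) (integrable_exp_mul_I h t)]
  calc _ ≤ ∫ ω, |t| * ‖(g - h) ω‖ ∂μ := by
        refine norm_integral_le_of_norm_le
          (((Lp.memLp (g - h)).integrable one_le_two).norm.const_mul _) ?_
        filter_upwards [Lp.coeFn_sub g h] with ω hω
        rw [hω, Pi.sub_apply, Real.norm_eq_abs, ← abs_mul, mul_sub]
        rw [← Complex.ofReal_mul, ← Complex.ofReal_mul]
        exact norm_exp_mul_I_sub_le (t * g ω) (t * h ω)
    _ ≤ _ := by
        rw [integral_const_mul]
        exact mul_le_mul_of_nonneg_left (integral_norm_le_norm (g - h)) (abs_nonneg t)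

/-- Characteristic functions determine the law. With the variance written as `‖g‖²`, both sides of
each resulting equation are continuous in `g`. -/
theorem isClosed_map_eq_gaussianReal [IsProbabilityMeasure μ] :
    IsClosed {g : Lp ℝ 2 μ | μ.map g = gaussianReal 0 (‖g‖₊ ^ 2)} := by
  have : {g : Lp ℝ 2 μ | μ.map g = gaussianReal 0 (‖g‖₊ ^ 2)} =
      ⋂ t : ℝ, {g : Lp ℝ 2 μ | charFun (μ.map g) t =
        Complex.exp (-(‖g‖ ^ 2 * t ^ 2 / 2 : ℝ))} := by
    ext g
    simp only [Set.mem_ofPred_eq, Set.mem_iInter]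
    have h (t : ℝ) : charFun (gaussianReal 0 (‖g‖₊ ^ 2)) t =
        Complex.exp (-(‖g‖ ^ 2 * t ^ 2 / 2 : ℝ)) := by
      rw [charFun_gaussianReal]
      congr 1
      push_cast
      ring
    constructor
    · intro hg t
      rw [hg, h]
    · intro hg
      have := Measure.isProbabilityMeasure_map (μ := μ)
        (Lp.aestronglyMeasurable g).aemeasurable
      refine Measure.ext_of_charFun (funext fun t => ?_)
      rw [hg, h]
  rw [this]
  refine isClosed_iInter fun t => isClosed_eq (continuous_charFun_map_Lp t) ?_
  fun_prop

theorem norm_sq_eq_integral (g : Lp ℝ 2 μ) : ‖g‖ ^ 2 = ∫ ω, g ω ^ 2 ∂μ := by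
  rw [← real_inner_self_eq_norm_sq, L2.inner_def]
  simp [pow_two]

theorem map_eq_gaussianReal_of_hasGaussianLaw {g : Lp ℝ 2 μ} (hg : HasGaussianLaw g μ)
    (h0 : ∫ ω, g ω ∂μ = 0) : μ.map g = gaussianReal 0 (‖g‖₊ ^ 2) := by
  rw [hg.map_eq_gaussianReal, h0, variance_of_integral_eq_zero hg.aemeasurable h0,
    ← norm_sq_eq_integral, Real.toNNReal_pow (norm_nonneg g), norm_toNNReal]

theorem hasGaussianLaw_of_map_eq {g : Lp ℝ 2 μ} (hg : μ.map g = gaussianReal 0 (‖g‖₊ ^ 2)) :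
    HasGaussianLaw g μ :=
  ⟨hg ▸ inferInstance⟩

theorem integral_eq_zero_of_map_eq {g : Lp ℝ 2 μ}
    (hg : μ.map g = gaussianReal 0 (‖g‖₊ ^ 2)) : ∫ ω, g ω ∂μ = 0 := by
  rw [← integral_map (f := fun x : ℝ => x) (Lp.aestronglyMeasurable g).aemeasurable
    (by fun_prop), hg, integral_id_gaussianReal]

/-- Every element of `gaussSpace hY` is a centred Gaussian variable. -/
theorem map_eq_gaussianReal_of_mem_gaussSpace [IsProbabilityMeasure μ] {F : Type*} [NormedAddCommGroup F]
    [NormedSpace ℝ F] [CompleteSpace F] [SecondCountableTopology F] [MeasurableSpace F]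
    [BorelSpace F] {Y : Ω → F} (hYG : HasGaussianLaw Y μ) (hY : MemLp Y 2 μ)
    (hY0 : ∫ ω, Y ω ∂μ = 0) {g : Lp ℝ 2 μ} (hg : g ∈ gaussSpace hY) :
    μ.map g = gaussianReal 0 (‖g‖₊ ^ 2) := by
  refine closure_minimal ?_ isClosed_map_eq_gaussianReal hg
  rintro _ ⟨f', rfl⟩
  have h : dualEval hY f' =ᵐ[μ] fun ω => f' (Y ω) := (f'.comp_memLp' hY).coeFn_toLp
  refine map_eq_gaussianReal_of_hasGaussianLaw ((hYG.map_fun f').congr h.symm) ?_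
  rw [integral_congr_ae h, f'.integral_comp_comm hYG.integrable, hY0, map_zero]

theorem coeFn_finset_sum {ι : Type*} (s : Finset ι) (c : ι → ℝ) (r : ι → Lp ℝ 2 μ) :
    ⇑(∑ i ∈ s, c i • r i) =ᵐ[μ] fun ω => ∑ i ∈ s, c i * r i ω := by
  classical
  induction s using Finset.induction_on with
  | empty =>
    filter_upwards [Lp.coeFn_zero ℝ 2 μ] with ω hω
    simpa only [Finset.sum_empty, Pi.zero_apply] using hω
  | insert a s ha ih =>
    rw [Finset.sum_insert ha]
    filter_upwards [ih, Lp.coeFn_add (c a • r a) (∑ i ∈ s, c i • r i),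
      Lp.coeFn_smul (c a) (r a)] with ω h1 h2 h3
    rw [h2, Pi.add_apply, h1, h3, Finset.sum_insert ha, Pi.smul_apply, smul_eq_mul]

theorem covariance_eq_inner [IsProbabilityMeasure μ] {g h : Lp ℝ 2 μ} (hg : ∫ ω, g ω ∂μ = 0) :
    cov[g, h; μ] = ⟪g, h⟫_ℝ := by
  rw [covariance_eq_sub (Lp.memLp g) (Lp.memLp h), hg, zero_mul, sub_zero, L2.inner_def]
  refine integral_congr_ae (ae_of_all _ fun ω => ?_)
  simp [mul_comm]

theorem covariance_congr_right {f g h : Ω → ℝ} (hgh : g =ᵐ[μ] h) :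
    cov[f, g; μ] = cov[f, h; μ] := by
  rw [covariance, covariance, integral_congr_ae hgh]
  refine integral_congr_ae ?_
  filter_upwards [hgh] with ω hω
  rw [hω]

/-- Linear combinations stay in `G`, so the family is jointly Gaussian, and for jointly Gaussian
variables zero covariance implies independence. -/
theorem indepFun_of_inner_eq_zero [IsProbabilityMeasure μ] {G : Submodule ℝ (Lp ℝ 2 μ)}
    (hG : ∀ g ∈ G, μ.map g = gaussianReal 0 (‖g‖₊ ^ 2)) {ι : Type*} [Fintype ι]
    {r : ι → Lp ℝ 2 μ} (hr : ∀ i, r i ∈ G) {g : Lp ℝ 2 μ} (hg : g ∈ G)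
    (h0 : ∀ i, ⟪g, r i⟫_ℝ = 0) : IndepFun g (fun ω i => r i ω) μ := by
  classical
  have hgm := (Lp.aestronglyMeasurable g).aemeasurable
  have hrm : AEMeasurable (fun ω i => r i ω) μ :=
    aemeasurable_pi_lambda _ fun i => (Lp.aestronglyMeasurable (r i)).aemeasurable
  have hjoint : HasGaussianLaw (fun ω => (g ω, fun i => r i ω)) μ := by
    -- A functional `L` of the joint vector is almost everywhere the element of `G` whose
    -- coefficients are the values of `L` on the standard basis.
    refine ⟨isGaussian_of_map_eq_gaussianReal fun L => ⟨0, ‖L (1, 0) • g +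
      ∑ i, L (0, Pi.single i 1) • r i‖₊ ^ 2, ?_⟩⟩
    rw [AEMeasurable.map_map_of_aemeasurable (by fun_prop) (hgm.prodMk hrm),
      ← hG _ (G.add_mem (G.smul_mem _ hg) (G.sum_mem fun i _ => G.smul_mem _ (hr i)))]
    refine Measure.map_congr ?_
    filter_upwards [coeFn_finset_sum Finset.univ (fun i => L (0, Pi.single i 1)) r,
      Lp.coeFn_add (L (1, 0) • g) (∑ i, L (0, Pi.single i 1) • r i),
      Lp.coeFn_smul (L (1, 0)) g] with ω h1 h2 h3
    rw [h2, Pi.add_apply, h1, h3, Pi.smul_apply, smul_eq_mul, Function.comp_apply]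
    have : (g ω, fun i => r i ω) = g ω • ((1, 0) : ℝ × (ι → ℝ)) +
        ∑ i, r i ω • ((0, Pi.single i 1) : ℝ × (ι → ℝ)) := by
      ext j
      · simp [Prod.fst_sum]
      · simp [Prod.snd_sum, Pi.single_apply]
    rw [this, map_add, map_smul, map_sum, smul_eq_mul, mul_comm]
    congr 1
    refine Finset.sum_congr rfl fun i _ => ?_
    rw [map_smul, smul_eq_mul, mul_comm]
  have h := HasGaussianLaw.indepFun_of_covariance_strongDual hjoint fun L₁ L₂ => ?_
  · exact h
  have e1 : L₁ ∘ g = fun ω => L₁ 1 * g ω := by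
    ext ω
    rw [Function.comp_apply, mul_comm, ← smul_eq_mul, ← map_smul, smul_eq_mul, mul_one]
  have e2 : (L₂ ∘ fun ω i => r i ω) =ᵐ[μ] ⇑(∑ i, L₂ (Pi.single i 1) • r i) := by
    filter_upwards [coeFn_finset_sum Finset.univ (fun i => L₂ (Pi.single i 1)) r] with ω h1
    rw [h1, Function.comp_apply]
    have : (fun i => r i ω) = ∑ i, r i ω • (Pi.single i 1 : ι → ℝ) := by
      ext j
      simp [Pi.single_apply]
    rw [this, map_sum]
    simp [mul_comm]
  rw [e1, covariance_const_mul_left, covariance_congr_right e2,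
    covariance_eq_inner (integral_eq_zero_of_map_eq (hG g hg)), inner_sum]
  simp [inner_smul_right, h0]

end Gaussian

/-! ### Lévy's upward theorem in separable Banach spaces -/

section Levy

variable {Ω : Type*} {m mΩ : MeasurableSpace Ω} {μ : Measure Ω}
  {F : Type*} [NormedAddCommGroup F] [NormedSpace ℝ F] [SecondCountableTopology F]

theorem ae_eq_of_forall_dual {U V : Ω → F}
    (h : ∀ f' : StrongDual ℝ F, (fun ω => f' (U ω)) =ᵐ[μ] fun ω => f' (V ω)) : U =ᵐ[μ] V := by
  have : (U - V) =ᵐ[μ] 0 := by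
    refine ae_eq_zero_of_forall_dual ℝ fun f' => ?_
    filter_upwards [h f'] with ω hω
    simp [hω]
  filter_upwards [this] with ω hω
  exact sub_eq_zero.1 hω

variable [CompleteSpace F] [IsProbabilityMeasure μ]

/-- Functionals commute with conditional expectation and separate points, so `U` agrees almost
everywhere with `μ[U | m]`. -/
theorem aestronglyMeasurable_of_forall_dual (hm : m ≤ mΩ) {U : Ω → F}
    (hU : Integrable U μ)
    (h : ∀ f' : StrongDual ℝ F, AEStronglyMeasurable[m] (fun ω => f' (U ω)) μ) :
    AEStronglyMeasurable[m] U μ := by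
  refine ⟨μ[U | m], stronglyMeasurable_condExp, (ae_eq_of_forall_dual fun f' => ?_).symm⟩
  exact (f'.comp_condExp_comm hU).trans
    (condExp_of_aestronglyMeasurable' hm (h f') (f'.integrable_comp hU))

/-- **Lévy's upward theorem** for random variables with values in a separable Banach space. -/
theorem tendsto_ae_condExp_banach (ℱ : Filtration ℕ mΩ) {U : Ω → F} (hU : Integrable U μ)
    (hm : AEStronglyMeasurable[⨆ n, ℱ n] U μ) :
    ∀ᵐ ω ∂μ, Tendsto (fun n => (μ[U | ℱ n]) ω) atTop (𝓝 (U ω)) := by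
  have hle : ⨆ n, ℱ n ≤ mΩ := iSup_le ℱ.le
  let y := TopologicalSpace.denseSeq F
  -- The scalar theorem is applied to the distances from a countable dense set; they dominate the
  -- distances of `μ[U | ℱ n]` from the same points.
  let D (k : ℕ) (ω : Ω) : ℝ := ‖U ω - y k‖
  have hD (k : ℕ) : Integrable (D k) μ := (hU.sub (integrable_const _)).norm
  have h1 : ∀ᵐ ω ∂μ, ∀ k, Tendsto (fun n => (μ[D k | ℱ n]) ω) atTop (𝓝 (D k ω)) := by
    refine ae_all_iff.2 fun k => ?_
    filter_upwards [tendsto_ae_condExp (μ := μ) (ℱ := ℱ) (D k),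
      condExp_of_aestronglyMeasurable' hle
        (continuous_norm.comp_aestronglyMeasurable
          (hm.sub stronglyMeasurable_const.aestronglyMeasurable)) (hD k)] with ω h1 h2
    exact h1.trans (congrArg 𝓝 h2).le
  have h2 : ∀ᵐ ω ∂μ, ∀ k n, ‖(μ[U | ℱ n]) ω - y k‖ ≤ (μ[D k | ℱ n]) ω := by
    refine ae_all_iff.2 fun k => ae_all_iff.2 fun n => ?_
    filter_upwards [norm_condExp_le (m := ℱ n) (μ := μ) (fun ω => U ω - y k),
      condExp_sub hU (integrable_const (y k)) (ℱ n)] with ω h1 h2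
    refine le_of_eq_of_le ?_ h1
    change _ = ‖(μ[U - fun _ => y k | ℱ n]) ω‖
    rw [h2, Pi.sub_apply, condExp_const (ℱ.le n)]
  filter_upwards [h1, h2] with ω h1 h2
  rw [Metric.tendsto_nhds]
  intro ε hε
  obtain ⟨k, hk⟩ := (TopologicalSpace.denseRange_denseSeq F).exists_dist_lt (U ω) (half_pos hε)
  rw [dist_eq_norm] at hk
  filter_upwards [(h1 k).eventually_lt_const hk] with n hn
  calc dist ((μ[U | ℱ n]) ω) (U ω) ≤ dist ((μ[U | ℱ n]) ω) (y k) + dist (U ω) (y k) :=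
        dist_triangle_right _ _ _
    _ < ε / 2 + ε / 2 := by
        rw [dist_eq_norm, dist_eq_norm]
        exact add_lt_add ((h2 k n).trans_lt hn) hk
    _ = ε := add_halves ε

end Levy

/-! ### Orthonormal expansions as conditional expectations -/

section Expansion

variable {Ω : Type*} [mΩ : MeasurableSpace Ω] {μ : Measure Ω}
  {G : Submodule ℝ (Lp ℝ 2 μ)} {J : Type*}

/-- The filtration generated by finitely many elements of `L²(μ)` at a time. -/
noncomputable def finsetFiltration (r : J → Lp ℝ 2 μ) {S : ℕ → Finset J} (hS : Monotone S) :
    Filtration ℕ mΩ where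
  seq n := ⨆ i ∈ S n, MeasurableSpace.comap (r i) (borel ℝ)
  mono' _ _ h := biSup_mono fun _ hi => hS h hi
  le' _ := iSup₂_le fun i _ => by
    rw [← BorelSpace.measurable_eq (α := ℝ)]
    exact (Lp.stronglyMeasurable (r i)).measurable.comap_le

theorem stronglyMeasurable_finsetFiltration (r : J → Lp ℝ 2 μ) {S : ℕ → Finset J}
    (hS : Monotone S) {n : ℕ} {i : J} (hi : i ∈ S n) :
    StronglyMeasurable[finsetFiltration r hS n] (r i) := by
  have h : MeasurableSpace.comap (r i) (borel ℝ) ≤ finsetFiltration r hS n :=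
    le_iSup₂ (f := fun i _ => MeasurableSpace.comap (r i) (borel ℝ)) i hi
  refine Measurable.stronglyMeasurable ?_
  rw [measurable_iff_comap_le, BorelSpace.measurable_eq (α := ℝ)]
  exact h

/-- The orthogonal projection `p` of `g` onto the span of the `r i`, `i ∈ S n`, is measurable for
the generated `σ`-algebra, while `g - p` is independent of it and has mean zero. -/
theorem condExp_finsetFiltration [IsProbabilityMeasure μ]
    (hG : ∀ g ∈ G, μ.map g = gaussianReal 0 (‖g‖₊ ^ 2))
    (r : HilbertBasis J ℝ G) {S : ℕ → Finset J} (hS : Monotone S) (n : ℕ) {g : Lp ℝ 2 μ}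
    (hg : g ∈ G) :
    μ[g | finsetFiltration (fun i => (r i : Lp ℝ 2 μ)) hS n] =ᵐ[μ]
      fun ω => ∑ i ∈ S n, ⟪(r i : Lp ℝ 2 μ), g⟫_ℝ * (r i : Lp ℝ 2 μ) ω := by
  classical
  set ℱ := finsetFiltration (fun i => (r i : Lp ℝ 2 μ)) hS
  set p : Lp ℝ 2 μ := ∑ i ∈ S n, ⟪(r i : Lp ℝ 2 μ), g⟫_ℝ • (r i : Lp ℝ 2 μ) with hp
  have hpG : p ∈ G := G.sum_mem fun i _ => G.smul_mem _ (r i).2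
  have hpc := coeFn_finset_sum (S n) (fun i => ⟪(r i : Lp ℝ 2 μ), g⟫_ℝ)
    (fun i => (r i : Lp ℝ 2 μ))
  have hpi : Integrable p μ := (Lp.memLp p).integrable one_le_two
  have hqi : Integrable (g - p : Lp ℝ 2 μ) μ := (Lp.memLp _).integrable one_le_two
  have horth (j : S n) : ⟪g - p, (r j : Lp ℝ 2 μ)⟫_ℝ = 0 := by
    have hon (i k : J) : ⟪(r i : Lp ℝ 2 μ), (r k : Lp ℝ 2 μ)⟫_ℝ = if i = k then 1 else 0 :=
      orthonormal_iff_ite.1 r.orthonormal i k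
    rw [inner_sub_left, hp, sum_inner]
    simp [inner_smul_left, hon, real_inner_comm]
  have hind := indepFun_of_inner_eq_zero hG (fun j : S n => (r j).2) (G.sub_mem hg hpG) horth
  have hℱ : ℱ n ≤ MeasurableSpace.comap (fun ω (j : S n) => (r j : Lp ℝ 2 μ) ω)
      MeasurableSpace.pi := by
    refine iSup₂_le fun i hi => ?_
    rw [← BorelSpace.measurable_eq (α := ℝ), ← measurable_iff_comap_le]
    exact (measurable_pi_apply (⟨i, hi⟩ : S n)).comp
      (comap_measurable fun ω (j : S n) => (r j : Lp ℝ 2 μ) ω)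
  have hq : μ[(g - p : Lp ℝ 2 μ) | ℱ n] =ᵐ[μ] fun _ => 0 := by
    have := condExp_indep_eq (Lp.stronglyMeasurable (g - p)).measurable.comap_le (ℱ.le n)
      (comap_measurable (g - p : Lp ℝ 2 μ)).stronglyMeasurable
      (indep_of_indep_of_le_right hind hℱ)
    rwa [integral_eq_zero_of_map_eq (hG _ (G.sub_mem hg hpG))] at this
  have hpm : μ[p | ℱ n] =ᵐ[μ] p := by
    refine condExp_of_aestronglyMeasurable' (ℱ.le n) ⟨_, ?_, hpc⟩ hpi
    exact Finset.stronglyMeasurable_fun_sum _ fun i hi =>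
      (stronglyMeasurable_finsetFiltration _ hS hi).const_mul _
  have hsum : g =ᵐ[μ] ⇑p + ⇑(g - p) := by
    filter_upwards [Lp.coeFn_sub g p] with ω hω
    rw [Pi.add_apply, hω, Pi.sub_apply, add_sub_cancel]
  filter_upwards [condExp_congr_ae (m := ℱ n) hsum, condExp_add hpi hqi (ℱ n), hq, hpm, hpc]
    with ω h1 h2 h3 h4 h5
  rw [h1, h2, Pi.add_apply, h3, h4, add_zero, h5]

/-- The measurable elements form a closed set in `L²(μ)`, which contains all finite partial sums of
the expansion of `g`. -/
theorem aestronglyMeasurable_iSup_finsetFiltration (r : HilbertBasis J ℝ G) {S : ℕ → Finset J}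
    (hS : Monotone S) (hS' : Tendsto S atTop atTop) {g : Lp ℝ 2 μ} (hg : g ∈ G) :
    AEStronglyMeasurable[⨆ n, finsetFiltration (fun i => (r i : Lp ℝ 2 μ)) hS n] g μ := by
  set ℱ := finsetFiltration (fun i => (r i : Lp ℝ 2 μ)) hS
  have hsum := (r.hasSum_repr ⟨g, hg⟩).map G.subtypeL G.subtypeL.continuous
  refine (isClosed_aestronglyMeasurable (p := 2) (F := ℝ) (iSup_le ℱ.le)).mem_of_tendsto hsum
    (Eventually.of_forall fun s => ?_)
  refine ⟨_, ?_, coeFn_finset_sum s (r.repr ⟨g, hg⟩) fun i => (r i : Lp ℝ 2 μ)⟩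
  refine Finset.stronglyMeasurable_fun_sum _ fun i _ => ?_
  obtain ⟨n, hn⟩ := (hS'.eventually_ge_atTop {i}).exists
  exact ((stronglyMeasurable_finsetFiltration _ hS (hn (Finset.mem_singleton_self i))).mono
    (le_iSup (fun n => ℱ n) n)).const_mul _

/-- The expansion of a random variable `U`, all of whose functionals lie in a space `G` of centred
Gaussian variables, along a Hilbert basis of `G` converges almost everywhere to `U`. -/
theorem tendsto_ae_sum_hilbertBasis [IsProbabilityMeasure μ] {F : Type*} [NormedAddCommGroup F] [NormedSpace ℝ F]
    [CompleteSpace F] [SecondCountableTopology F]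
    (hG : ∀ g ∈ G, μ.map g = gaussianReal 0 (‖g‖₊ ^ 2)) {U : Ω → F} (hU : MemLp U 2 μ)
    (hUG : ∀ f' : StrongDual ℝ F, dualEval hU f' ∈ G) (r : HilbertBasis J ℝ G)
    {S : ℕ → Finset J} (hS : Monotone S) (hS' : Tendsto S atTop atTop) :
    ∀ᵐ ω ∂μ, Tendsto (fun n => ∑ i ∈ S n, (r i : Lp ℝ 2 μ) ω • weightedMean hU (r i)) atTop
      (𝓝 (U ω)) := by
  set ℱ := finsetFiltration (fun i => (r i : Lp ℝ 2 μ)) hS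
  have hUi : Integrable U μ := hU.integrable one_le_two
  have hdual (f' : StrongDual ℝ F) : dualEval hU f' =ᵐ[μ] fun ω => f' (U ω) :=
    (f'.comp_memLp' hU).coeFn_toLp
  have hm : AEStronglyMeasurable[⨆ n, ℱ n] U μ :=
    aestronglyMeasurable_of_forall_dual (iSup_le ℱ.le) hUi fun f' =>
      (aestronglyMeasurable_iSup_finsetFiltration r hS hS' (hUG f')).congr (hdual f')
  -- Tested on `f'`, this is the scalar formula for `f'(U)`, because `f'(∫ r i U dμ) = ⟪f'(U), r
  -- i⟫`.
  have hc (n : ℕ) : μ[U | ℱ n] =ᵐ[μ]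
      fun ω => ∑ i ∈ S n, (r i : Lp ℝ 2 μ) ω • weightedMean hU (r i) := by
    refine ae_eq_of_forall_dual fun f' => ?_
    filter_upwards [f'.comp_condExp_comm (m := ℱ n) hUi,
      condExp_congr_ae (m := ℱ n) (hdual f'), condExp_finsetFiltration hG r hS n (hUG f')]
      with ω h1 h2 h3
    change f' ((μ[U | ℱ n]) ω) = _ at h1
    rw [h1]
    refine h2.symm.trans (h3.trans ?_)
    rw [map_sum]
    refine Finset.sum_congr rfl fun i _ => ?_
    rw [map_smul, dual_weightedMean, smul_eq_mul, mul_comm, real_inner_comm]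
  filter_upwards [tendsto_ae_condExp_banach ℱ hUi hm, ae_all_iff.2 hc] with ω h1 h2
  exact h1.congr h2

end Expansion

end GaussianConditioning
namespace GaussianConditioning

/-! ### Separability of the Gaussian space -/

section Separability

theorem exists_countable_hilbertBasis (H : Type*) [NormedAddCommGroup H] [InnerProductSpace ℝ H]
    [CompleteSpace H] [TopologicalSpace.SeparableSpace H] :
    ∃ (J : Type) (_ : Countable J), Nonempty (HilbertBasis J ℝ H) := by
  obtain ⟨w, b, hb⟩ := exists_hilbertBasis ℝ H
  have hw : w.Countable := by
    refine Set.PairwiseDisjoint.countable_of_isOpen (s := fun x => Metric.ball x (1 / 2))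
      (fun x hx y hy hxy => Metric.ball_disjoint_ball ?_) (fun x _ => Metric.isOpen_ball)
      fun x _ => ⟨x, Metric.mem_ball_self (by norm_num)⟩
    have hon : Orthonormal ℝ ((↑) : w → H) := hb ▸ b.orthonormal
    have h0 : ⟪x, y⟫_ℝ = 0 := hon.2 (i := ⟨x, hx⟩) (j := ⟨y, hy⟩) fun h => hxy (congrArg Subtype.val h)
    have hx1 : ‖x‖ = 1 := hon.1 ⟨x, hx⟩
    have hy1 : ‖y‖ = 1 := hon.1 ⟨y, hy⟩
    have h := norm_sub_sq_real x y
    rw [h0, hx1, hy1] at h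
    rw [dist_eq_norm]
    -- Orthonormal vectors have squared distance 2, so balls of radius 1/2 around them are disjoint.
    nlinarith [norm_nonneg (x - y)]
  have : Countable w := hw
  -- `IsCopy` admits only index sets in `Type`, so the countable set `w` is moved there.
  let e := equivShrink.{0} w
  refine ⟨Shrink.{0} w, e.symm.injective.countable,
    ⟨HilbertBasis.mk (b.orthonormal.comp e.symm e.symm.injective) ?_⟩⟩
  rw [e.symm.surjective.range_comp, b.dense_span]

variable {Ω : Type*} [mΩ : MeasurableSpace Ω] {μ : Measure Ω}
  {F : Type*} [NormedAddCommGroup F] [NormedSpace ℝ F]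
  [MeasurableSpace F] [BorelSpace F] {Y : Ω → F}

theorem separableSpace_lpMeas {Ω : Type*} {m mΩ : MeasurableSpace Ω} (μ : Measure Ω)
    [IsFiniteMeasure μ] (hm : m ≤ mΩ) (hc : @MeasurableSpace.CountablyGenerated Ω m) :
    TopologicalSpace.SeparableSpace (lpMeas ℝ ℝ m 2 μ) := by
  have : Fact ((2 : ℝ≥0∞) ≠ ∞) := ⟨ENNReal.ofNat_ne_top⟩
  have : SecondCountableTopology (@Lp Ω ℝ m _ 2 (μ.trim hm)) := inferInstance
  exact (lpMeasToLpTrimLie ℝ ℝ 2 μ hm).symm.surjective.denseRange.separableSpace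
    (lpMeasToLpTrimLie ℝ ℝ 2 μ hm).symm.continuous

theorem gaussSpace_le_lpMeas (hYm : Measurable Y) (hY : MemLp Y 2 μ) :
    gaussSpace hY ≤ lpMeas ℝ ℝ (MeasurableSpace.comap Y inferInstance) 2 μ := by
  refine Submodule.topologicalClosure_minimal _ ?_ (isClosed_aestronglyMeasurable hYm.comap_le)
  rintro _ ⟨f', rfl⟩
  refine mem_lpMeas_iff_aestronglyMeasurable.2
    ⟨fun ω => f' (Y ω), Measurable.stronglyMeasurable ?_, (f'.comp_memLp' hY).coeFn_toLp⟩
  exact f'.measurable.comp (comap_measurable Y)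

/-- `G_Y` lies in the `L²` space of the `σ`-algebra pulled back along `Y`, which is countably
generated because the Borel `σ`-algebra of `F` is. -/
theorem separableSpace_gaussSpace [IsFiniteMeasure μ] [SecondCountableTopology F]
    (hYm : Measurable Y) (hY : MemLp Y 2 μ) :
    TopologicalSpace.SeparableSpace (gaussSpace hY) := by
  have := separableSpace_lpMeas μ hYm.comap_le (MeasurableSpace.CountablyGenerated.comap Y)
  refine ((TopologicalSpace.isSeparable_range continuous_subtype_val).mono
    (u := (gaussSpace hY : Set (Lp ℝ 2 μ))) fun g hg =>
      ⟨(⟨g, gaussSpace_le_lpMeas hYm hY hg⟩ : lpMeas ℝ ℝ _ 2 μ), rfl⟩).separableSpace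

end Separability

/-! ### The copy of `F` over `W_Z` -/

section Copy

variable {Ω E F : Type*} [MeasurableSpace Ω] {μ : Measure Ω}
  [NormedAddCommGroup E] [NormedSpace ℝ E] [CompleteSpace E]
  [NormedAddCommGroup F] [NormedSpace ℝ F] [CompleteSpace F] {Y : Ω → F} {Z : Ω → E}

theorem norm_weightedMean_le (hY : MemLp Y 2 μ) (g : Lp ℝ 2 μ) :
    ‖weightedMean hY g‖ ≤ ‖hY.toLp Y‖ * ‖g‖ := by
  have h : weightedMean hY g = ∫ ω, (g • hY.toLp Y : Lp F 1 μ) ω ∂μ := by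
    refine integral_congr_ae ?_
    filter_upwards [Lp.coeFn_lpSMul (r := 1) g (hY.toLp Y), hY.coeFn_toLp] with ω h1 h2
    rw [h1, Pi.smul_apply', h2]
  rw [h, ← L1.integral_eq_integral, mul_comm]
  exact (L1.norm_integral_le _).trans (Lp.norm_smul_le g (hY.toLp Y))

/-- The map `W_Z → F` that takes `∫ g Z dμ` with `g ∈ G_Z` to `∫ g Y dμ`. If `G_Y = G_Z`, it is the
inverse of `M_W`, followed by the inclusion of `W_Y` in `F`; so `F` itself, into which `W_Z` is
embedded in this way, serves as the copy of `F` over `W_Z`. -/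
noncomputable def transfer (hY : MemLp Y 2 μ) (hZ : MemLp Z 2 μ) : WienerSpace hZ →L[ℝ] F :=
  LinearMap.mkContinuous
    ((weightedMean hY).comp ((gaussSpace hZ).subtype.comp
      (wienerIsometry hZ).symm.toLinearEquiv.toLinearMap)) ‖hY.toLp Y‖ fun w =>
    (norm_weightedMean_le hY _).trans_eq
      (congrArg (‖hY.toLp Y‖ * ·) ((wienerIsometry hZ).symm.norm_map w))

theorem transfer_apply (hY : MemLp Y 2 μ) (hZ : MemLp Z 2 μ) (w : WienerSpace hZ) :
    transfer hY hZ w = weightedMean hY ((wienerIsometry hZ).symm w : Lp ℝ 2 μ) := rfl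

theorem vHat_coe (hZ : MemLp Z 2 μ) (g : gaussSpace hZ) :
    vHat hZ g = wienerIsometry hZ g := rfl

theorem transfer_vHat (hY : MemLp Y 2 μ) (hZ : MemLp Z 2 μ) (g : gaussSpace hZ) :
    transfer hY hZ (vHat hZ g) = weightedMean hY g := by
  rw [transfer_apply, vHat_coe, LinearIsometryEquiv.symm_apply_apply]

theorem transfer_injective (hY : MemLp Y 2 μ) (hZ : MemLp Z 2 μ)
    (hG : gaussSpace hY = gaussSpace hZ) : Function.Injective (transfer hY hZ) := by
  refine (injective_iff_map_eq_zero _).2 fun w hw => ?_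
  rw [transfer_apply, weightedMean_eq_zero_iff, hG] at hw
  have h0 := (Submodule.mem_bot ℝ).1 ((Submodule.inf_orthogonal_eq_bot (gaussSpace hZ)).le
    ⟨((wienerIsometry hZ).symm w).2, hw⟩)
  exact (wienerIsometry hZ).symm.map_eq_zero_iff.1 (Subtype.ext h0)

theorem vHat_eq_wienerIsometry (hY : MemLp Y 2 μ) (g : Lp ℝ 2 μ) :
    vHat hY g = wienerIsometry hY ((gaussSpace hY).orthogonalProjectionOnto g) :=
  Subtype.ext (weightedMean_proj hY g).symm

/-- `V̂_Y` is the orthogonal projection onto `G_Y` followed by the isometry `V_Y`; its adjoint is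
therefore `V_Y⁻¹` followed by the inclusion. -/
theorem adjoint_vHat (hY : MemLp Y 2 μ) (w : WienerSpace hY) :
    ContinuousLinearMap.adjoint (vHat hY) w = (wienerIsometry hY).symm w := by
  refine ext_inner_right ℝ fun g => ?_
  rw [ContinuousLinearMap.adjoint_inner_left, vHat_eq_wienerIsometry,
    ← LinearIsometryEquiv.inner_map_map (wienerIsometry hY).symm,
    LinearIsometryEquiv.symm_apply_apply, Submodule.inner_orthogonalProjectionOnto_eq_of_mem_left]

theorem incl_eq_weightedMean (hY : MemLp Y 2 μ) (w : WienerSpace hY) :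
    WienerSpace.incl hY w = weightedMean hY ((wienerIsometry hY).symm w : Lp ℝ 2 μ) :=
  congrArg (WienerSpace.incl hY) ((wienerIsometry hY).apply_symm_apply w).symm

theorem transfer_opMW (hY : MemLp Y 2 μ) (hZ : MemLp Z 2 μ)
    (hG : gaussSpace hY = gaussSpace hZ) (w : WienerSpace hY) :
    transfer hY hZ (opMW hY hZ w) = WienerSpace.incl hY w := by
  rw [incl_eq_weightedMean, opMW, ContinuousLinearMap.comp_apply, adjoint_vHat]
  exact transfer_vHat hY hZ ⟨_, hG ▸ ((wienerIsometry hY).symm w).2⟩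

theorem isCopy_transfer [IsProbabilityMeasure μ] [SecondCountableTopology E]
    [SecondCountableTopology F] (hY : MemLp Y 2 μ) (hZ : MemLp Z 2 μ)
    (hG : gaussSpace hY = gaussSpace hZ)
    (hgauss : ∀ g ∈ gaussSpace hZ, μ.map g = gaussianReal 0 (‖g‖₊ ^ 2)) :
    IsCopy hZ (transfer hY hZ) Y := by
  intro J _ r S hS hS'
  have hYG (f' : StrongDual ℝ F) : dualEval hY f' ∈ gaussSpace hZ :=
    hG ▸ subset_closure ⟨f', rfl⟩
  have hZG (e' : StrongDual ℝ E) : dualEval hZ e' ∈ gaussSpace hZ := subset_closure ⟨e', rfl⟩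
  filter_upwards [tendsto_ae_sum_hilbertBasis hgauss hZ hZG r hS hS',
    tendsto_ae_sum_hilbertBasis hgauss hY hYG r hS hS'] with ω h1 h2
  refine ⟨h1.congr fun n => ?_, h2.congr fun n => ?_⟩
  · rw [map_sum]
    refine Finset.sum_congr rfl fun i _ => ?_
    rw [map_smul]
    rfl
  · rw [map_sum]
    refine Finset.sum_congr rfl fun i _ => ?_
    rw [map_smul, transfer_vHat]

/-- `i` and `k` send the same `W_Z`-valued partial sums to one sequence in `H`, whose limit is
unique. -/
theorem IsCopy.ae_eq_of_agree {hZ : MemLp Z 2 μ} {E₁ : Type*} [NormedAddCommGroup E₁]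
    [NormedSpace ℝ E₁] {j : WienerSpace hZ →L[ℝ] E₁} {U : Ω → E₁} (h : IsCopy hZ j U)
    [TopologicalSpace.SeparableSpace (gaussSpace hZ)] {H : Type*} [AddCommGroup H] [Module ℝ H]
    [TopologicalSpace H] [T2Space H] (i : E →L[ℝ] H) (k : E₁ →L[ℝ] H)
    (hik : ∀ z, i (WienerSpace.incl hZ z) = k (j z)) : ∀ᵐ ω ∂μ, i (Z ω) = k (U ω) := by
  obtain ⟨J, _, ⟨r⟩⟩ := exists_countable_hilbertBasis (gaussSpace hZ)
  obtain ⟨S, hS, hS'⟩ := exists_seq_monotone_tendsto_atTop_atTop (Finset J)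
  filter_upwards [h J r S hS hS'] with ω hω
  refine tendsto_nhds_unique ((i.continuous.tendsto _).comp hω.1) ?_
  exact ((k.continuous.tendsto _).comp hω.2).congr fun n => (hik _).symm

end Copy

end GaussianConditioning

/-! ### The main theorem -/

theorem mainTheorem6 {Ω : Type w} [MeasurableSpace Ω] (μ : Measure Ω) [IsProbabilityMeasure μ]
    {E : Type u} [NormedAddCommGroup E] [NormedSpace ℝ E] [CompleteSpace E]
    [SecondCountableTopology E] [MeasurableSpace E] [BorelSpace E]
    {F : Type v} [NormedAddCommGroup F] [NormedSpace ℝ F] [CompleteSpace F]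
    [SecondCountableTopology F] [MeasurableSpace F] [BorelSpace F]
    (X : Ω → E) (Y : Ω → F) (hX : Measurable X) (hY : Measurable Y)
    (hXY : HasGaussianLaw (fun ω => (X ω, Y ω)) μ)
    (hX0 : ∫ ω, X ω ∂μ = 0) (hY0 : ∫ ω, Y ω ∂μ = 0)
    (hG : GaussianConditioning.gaussSpace hXY.snd.memLp_two =
      GaussianConditioning.gaussSpace
        (GaussianConditioning.memLp_condMean hXY.fst.memLp_two Y))
    (hW : Dense (GaussianConditioning.wienerSubmodule hXY.snd.memLp_two : Set F)) :
    ∃ (E₁ : Type v) (_ : NormedAddCommGroup E₁) (_ : NormedSpace ℝ E₁) (_ : CompleteSpace E₁)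
      (j : GaussianConditioning.WienerSpace
        (GaussianConditioning.memLp_condMean hXY.fst.memLp_two Y) →L[ℝ] E₁)
      (M : F ≃ₗᵢ[ℝ] E₁),
      Function.Injective j ∧
      (∀ y : GaussianConditioning.WienerSpace hXY.snd.memLp_two,
        M (GaussianConditioning.WienerSpace.incl hXY.snd.memLp_two y) =
          j (GaussianConditioning.opMW hXY.snd.memLp_two
            (GaussianConditioning.memLp_condMean hXY.fst.memLp_two Y) y)) ∧
      GaussianConditioning.IsCopy
        (GaussianConditioning.memLp_condMean hXY.fst.memLp_two Y) j (fun ω => M (Y ω)) ∧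
      (∀ (H : Type (max u v)) [AddCommGroup H] [Module ℝ H] [TopologicalSpace H]
        [IsTopologicalAddGroup H] [ContinuousSMul ℝ H] [T2Space H]
        (i : E →L[ℝ] H) (k : E₁ →L[ℝ] H),
        (∀ z : GaussianConditioning.WienerSpace
            (GaussianConditioning.memLp_condMean hXY.fst.memLp_two Y),
          i (GaussianConditioning.WienerSpace.incl _ z) = k (j z)) →
        ∀ᵐ ω ∂μ, i (GaussianConditioning.condMean X Y μ ω) = k (M (Y ω))) := by
  set hY2 := hXY.snd.memLp_two
  set hZ2 := GaussianConditioning.memLp_condMean hXY.fst.memLp_two Y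
  -- Gaussianity of `G_Z` is inherited from `Y` through `G_Y = G_Z`.
  have hgauss (g : Lp ℝ 2 μ) (hg : g ∈ GaussianConditioning.gaussSpace hZ2) :
      μ.map g = gaussianReal 0 (‖g‖₊ ^ 2) :=
    GaussianConditioning.map_eq_gaussianReal_of_mem_gaussSpace hXY.snd hY2 hY0 (hG ▸ hg)
  have hcopy := GaussianConditioning.isCopy_transfer hY2 hZ2 hG hgauss
  refine ⟨F, inferInstance, inferInstance, inferInstance,
    GaussianConditioning.transfer hY2 hZ2, LinearIsometryEquiv.refl ℝ F,
    GaussianConditioning.transfer_injective hY2 hZ2 hG,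
    fun y => (GaussianConditioning.transfer_opMW hY2 hZ2 hG y).symm, hcopy, ?_⟩
  intro H _ _ _ _ _ _ i k hik
  have : TopologicalSpace.SeparableSpace (GaussianConditioning.gaussSpace hZ2) :=
    hG ▸ GaussianConditioning.separableSpace_gaussSpace hY hY2
  exact hcopy.ae_eq_of_agree i k hik
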